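/- Let $G$ be a locally compact (Hausdorff) abelian group, written additively, with a fixed Haar measure $du$; let $(\Omega,\mu)$ be an arbitrary measure space, and let $1\le p<\infty$, all $L^p$ spaces being over the same scalar field $\mathbb K=\mathbb R$ or $\mathbb C$. Let $u\mapsto R_u$ be a strongly continuous representation of $G$ by bounded linear operators on $L^p(\mu)$ (so $R_0=I$, $R_{u+v}=R_uR_v$, and $u\mapsto R_uf$ is continuous for each $f\in L^p(\mu)$) with $c=\sup\{\|R_u\|:u\in G\}<\infty$. For a finite or infinite sequence $\{k_j\}$ in $L^1(G)$ let $N_{p,2}(\{k_j\})$ denote the smallest constant $C\in[0,\infty]$ such that $$\Big\|\Big(\sum_j|k_j*f|^2\Big)^{1/2}\Big\|_{L^p(G)}\le C\,\|f\|_{L^p(G)}\quad\text{for all } f\in L^p(G),$$ where $(k*f)(v)=\int_G k(u)f(v-u)\,du$. For $f\in L^p(\mu)$ put $T_{k_j}f=\int_G k_j(u)R_{-u}f\,du$. Then the Bochner integrals defining $T_{k_j}f$ exist in $L^p(\mu)$, and if $N_{p,2}(\{k_j\})<\infty$, then the operator $$Tf(x)=\Big(\sum_j|T_{k_j}f(x)|^2\Big)^{1/2}$$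 is bounded from $L^p(\mu)$ into itself with norm $\|T\|_p\le c^2N_{p,2}(\{k_j\})$: for every $f\in L^p(\mu)$, $Tf$ is finite $\mu$-almost everywhere, belongs to $L^p(\mu)$, and $\|Tf\|_{L^p(\mu)}\le c^2N_{p,2}(\{k_j\})\|f\|_{L^p(\mu)}$. -/

import Mathlib

open MeasureTheory
open scoped NNReal ENNReal

/-- A strongly continuous representation of an (additively written) topological group `G`
by bounded linear operators on a normed space `E`. -/
structure IsStronglyContinuousRep {𝕜 G E : Type*} [RCLike 𝕜] [AddGroup G] [TopologicalSpace G]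
    [NormedAddCommGroup E] [NormedSpace 𝕜 E] (R : G → E →L[𝕜] E) : Prop where
  map_zero : R 0 = ContinuousLinearMap.id 𝕜 E
  map_add : ∀ u v : G, R (u + v) = (R u).comp (R v)
  continuous_apply : ∀ x : E, Continuous fun u : G => R u x

/-- The square function `x ↦ (∑ⱼ |Fⱼ(x)|²)^{1/2}` of a family of functions, with values
in `[0, ∞]`. -/
noncomputable def squareFunction {ι α 𝕜 : Type*} [RCLike 𝕜] (F : ι → α → 𝕜) (x : α) : ℝ≥0∞ :=
  (∑' j, ‖F j x‖ₑ ^ 2) ^ (1 / 2 : ℝ)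

/-- The convolution `(k * f)(v) = ∫ k(u) f(v - u) dν(u)` of scalar functions on `G`. -/
noncomputable def scalarConv {G 𝕜 : Type*} [RCLike 𝕜] [AddCommGroup G] [MeasurableSpace G]
    (ν : Measure G) (k f : G → 𝕜) : G → 𝕜 :=
  convolution k f (ContinuousLinearMap.mul 𝕜 𝕜) ν

/-- `N_{p,2}({kⱼ})`: the smallest `C ∈ [0, ∞]` such that
`‖(∑ⱼ |kⱼ * f|²)^{1/2}‖_p ≤ C ‖f‖_p` for all `f ∈ L^p(G)`. -/
noncomputable def squareNorm {ι G 𝕜 : Type*} [RCLike 𝕜] [AddCommGroup G] [MeasurableSpace G]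
    (ν : Measure G) (p : ℝ≥0∞) (k : ι → G → 𝕜) : ℝ≥0∞ :=
  sInf {C : ℝ≥0∞ | ∀ f : G → 𝕜, MemLp f p ν →
    eLpNorm (squareFunction fun j => scalarConv ν (k j) f) p ν ≤ C * eLpNorm f p ν}

/-- The operator `T_k x = ∫ k(u) R_{-u} x dν(u)`, a Bochner integral in `E`. -/
noncomputable def transferOp {G 𝕜 E : Type*} [RCLike 𝕜] [AddCommGroup G] [MeasurableSpace G]
    [NormedAddCommGroup E] [NormedSpace 𝕜 E] [NormedSpace ℝ E]
    (ν : Measure G) (R : G → E →L[𝕜] E) (k : G → 𝕜) (x : E) : E :=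
  ∫ u, k u • R (-u) x ∂ν

/-!
The argument is transference in the style of Calderón and Coifman–Weiss. Write
`‖(hⱼ)‖ = ‖(∑ⱼ |hⱼ|²)^{1/2}‖_p` and let `v` be any element of `G`. Since `R v` commutes with the
operators `T_{kⱼ}`,

  `T_{kⱼ} f = R (-v) ∫ kⱼ(u) R (v - u) f du`,

and `R (-v)` costs a factor at most `c` because, by the Marcinkiewicz–Zygmund inequality, an operator
on `L^p(μ)` acts on `ℓ²`-valued functions with the same norm
(`eLpNorm_squareFunction_clm_le`). The integral is the convolution of `kⱼ` with the orbit
`u ↦ R u f`. Averaging over `v` in a set `V` and cutting the orbit off outside a neighbourhood `O` of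
`V - K`, where `K` carries most of the mass of the kernels, one may apply the scalar convolution
inequality for each fixed `x ∈ Ω`; as the orbit is bounded by `c ‖f‖`, the result is
`‖(T_{kⱼ} f)ⱼ‖ ≤ c N (ν O / ν V)^{1/p} c ‖f‖` up to small errors, and the Følner condition
(`exists_foelner_pair`) makes the ratio `ν O / ν V` as close to one as desired.

Neither `μ` nor `ν` is assumed σ-finite and `G` need not be second countable, so `(u, x) ↦ R u f (x)`
may have no jointly measurable version. On the compact set `V - K` the orbit is therefore replaced
by a finite sum `∑ i, φ i • R (w i) f` with continuous `φ i`
(`exists_subpartition_norm_sub_sum_le`), for which every function in sight is measurable and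
Tonelli's theorem holds (`lintegral_lintegral_swap_of_memLp`). This gives
`eLpNorm_squareFunction_transferOp_le` for finitely many kernels; monotone convergence extends it
to countably many.

The Marcinkiewicz–Zygmund inequality with constant one comes from a unitarily invariant measure on
`𝕜ᴶ`: integrating the bound for `∑ⱼ z̄ⱼ gⱼ` in `z` turns `|⟨z, g(x)⟩|^p` into a multiple of
`(∑ⱼ |gⱼ(x)|²)^{p/2}`. The Følner condition comes from the polynomial growth of `ν (n • L)` for a
compact neighbourhood `L` of zero in an abelian group.
-/

/-! ### Følner pairs in locally compact abelian groups -/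

section Foelner

open Set
open scoped Pointwise Topology

variable {G : Type*} [AddCommGroup G]

/-- If `L + L` is covered by the translates `x + L`, `x ∈ F`, then `n • L` is covered by the
translates of `L` by the sums `∑ x ∈ F, mₓ • x` with `mₓ ≤ n`. Because the group is commutative,
there are only polynomially many of these. -/
theorem nsmul_subset_biUnion_vadd [DecidableEq G] {L : Set G} (h0 : (0 : G) ∈ L) {F : Finset G}
    (hF : L + L ⊆ ⋃ x ∈ F, x +ᵥ L) (n : ℕ) :
    n • L ⊆ ⋃ m ∈ Fintype.piFinset fun _ : F => Finset.range (n + 1),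
      (∑ x : F, m x • (x : G)) +ᵥ L := by
  induction n with
  | zero =>
    intro x hx
    obtain rfl : x = 0 := by simpa using hx
    simp only [mem_iUnion]
    exact ⟨fun _ => 0, by simp, by simpa using h0⟩
  | succ n ih =>
    rw [succ_nsmul]
    rintro _ ⟨x, hx, l, hl, rfl⟩
    obtain ⟨m, hm, l', hl', rfl⟩ : ∃ m ∈ Fintype.piFinset fun _ : F => Finset.range (n + 1),
        ∃ l' ∈ L, (∑ x : F, m x • (x : G)) + l' = x := by
      simpa [mem_vadd_set] using ih hx
    obtain ⟨y, hy, l'', hl'', h⟩ : ∃ y ∈ F, ∃ l'' ∈ L, y + l'' = l' + l := by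
      simpa [mem_vadd_set] using hF (add_mem_add hl' hl)
    simp only [mem_iUnion]
    refine ⟨m + Pi.single ⟨y, hy⟩ 1, ?_, l'', hl'', ?_⟩
    · simp only [Fintype.mem_piFinset, Finset.mem_range] at hm ⊢
      intro z
      have := hm z
      by_cases hz : z = ⟨y, hy⟩
      · subst hz; simp; omega
      · simp [Pi.single_eq_of_ne hz]; omega
    · simp only [Pi.add_apply, add_smul, Finset.sum_add_distrib, vadd_eq_add]
      have hs : ∑ z : F, (Pi.single (⟨y, hy⟩ : F) 1 : F → ℕ) z • (z : G) = y := by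
        rw [Finset.sum_eq_single (⟨y, hy⟩ : F)
          (fun z _ hz => by rw [Pi.single_eq_of_ne hz, zero_smul]) (by simp)]
        simp
      rw [hs, add_assoc, h, ← add_assoc]

variable [TopologicalSpace G] [IsTopologicalAddGroup G]

theorem isCompact_succ_nsmul {L : Set G} (hL : IsCompact L) (n : ℕ) :
    IsCompact ((n + 1) • L) := by
  induction n with
  | zero => simpa using hL
  | succ n ih =>
    rw [succ_nsmul]
    exact ih.add hL

variable [MeasurableSpace G]
  (ν : Measure G) [ν.IsAddHaarMeasure]

theorem exists_measure_nsmul_le {L : Set G} (hL : IsCompact L) (hL0 : L ∈ 𝓝 (0 : G)) :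
    ∃ d : ℕ, ∀ n : ℕ, ν (n • L) ≤ ((n + 1 : ℕ) : ℝ≥0∞) ^ d * ν L := by
  classical
  obtain ⟨F, hF⟩ : ∃ F : Finset G, L + L ⊆ ⋃ x ∈ F, x +ᵥ interior L := by
    refine (hL.add hL).elim_finite_subcover (fun x : G => x +ᵥ interior L)
      (fun x => isOpen_interior.vadd x) fun x _ => mem_iUnion.2 ⟨x, 0, ?_, by simp⟩
    exact mem_interior_iff_mem_nhds.2 hL0
  have hF' : L + L ⊆ ⋃ x ∈ F, x +ᵥ L :=
    hF.trans (iUnion₂_mono fun x _ => vadd_set_mono interior_subset)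
  refine ⟨F.card, fun n => ?_⟩
  calc ν (n • L) ≤ ν (⋃ m ∈ Fintype.piFinset fun _ : F => Finset.range (n + 1),
          (∑ x : F, m x • (x : G)) +ᵥ L) :=
        measure_mono (nsmul_subset_biUnion_vadd (mem_of_mem_nhds hL0) hF' n)
    _ ≤ ∑ m ∈ Fintype.piFinset fun _ : F => Finset.range (n + 1),
          ν ((∑ x : F, m x • (x : G)) +ᵥ L) := measure_biUnion_finset_le _ _
    _ = ((n + 1 : ℕ) : ℝ≥0∞) ^ F.card * ν L := by
        simp [measure_vadd, Fintype.card_piFinset]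

/-- Compact neighbourhoods of `0` in an abelian group have polynomial growth, so the ratios
`ν ((n + 2) • L) / ν (n • L)` cannot stay above `r > 1`. -/
theorem exists_measure_add_two_nsmul_le {L : Set G} (hL : IsCompact L) (hL0 : L ∈ 𝓝 (0 : G))
    {r : ℝ≥0} (hr : 1 < r) :
    ∃ n : ℕ, ν ((n + 3) • L) ≤ r * ν ((n + 1) • L) := by
  by_contra! H
  obtain ⟨d, hd⟩ := exists_measure_nsmul_le ν hL hL0
  have hpos : ν L ≠ 0 := (Measure.measure_pos_of_mem_nhds ν hL0).ne'
  have hfin : ν L ≠ ∞ := hL.measure_ne_top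
  have hlow : ∀ m : ℕ, (r : ℝ≥0∞) ^ m * ν L ≤ ν ((2 * m + 1) • L) := by
    intro m
    induction m with
    | zero => simp
    | succ m ih =>
      calc (r : ℝ≥0∞) ^ (m + 1) * ν L = r * ((r : ℝ≥0∞) ^ m * ν L) := by ring
        _ ≤ r * ν ((2 * m + 1) • L) := by gcongr
        _ ≤ ν ((2 * (m + 1) + 1) • L) := (H (2 * m)).le
  have hpoly : ∀ m : ℕ, (r : ℝ) ^ m ≤ (2 * m + 2 : ℝ) ^ d := by
    intro m
    have h := (hlow m).trans (hd (2 * m + 1))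
    rw [ENNReal.mul_le_mul_iff_left hpos hfin] at h
    have h' : r ^ m ≤ ((2 * m + 1 + 1 : ℕ) : ℝ≥0) ^ d := by exact_mod_cast h
    have h'' : (r : ℝ) ^ m ≤ ((2 * m + 1 + 1 : ℕ) : ℝ) ^ d := by exact_mod_cast h'
    refine h''.trans (le_of_eq ?_)
    push_cast
    ring
  have hlim := tendsto_pow_const_div_const_pow_of_one_lt d (r := r) (by exact_mod_cast hr)
  obtain ⟨m, hm, hm1⟩ := ((hlim.eventually_lt_const (u := (4 ^ d : ℝ)⁻¹) (by positivity)).and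
    (Filter.eventually_ge_atTop 1)).exists
  have hrm : 0 < (r : ℝ) ^ m := pow_pos (by exact_mod_cast one_pos.trans hr) m
  rw [div_lt_iff₀ hrm, inv_mul_eq_div, lt_div_iff₀ (by positivity)] at hm
  have hm1' : (1 : ℝ) ≤ m := by exact_mod_cast hm1
  have : (2 * m + 2 : ℝ) ^ d ≤ (m : ℝ) ^ d * 4 ^ d := by
    rw [← mul_pow]
    gcongr
    linarith
  linarith [hpoly m]

variable [LocallyCompactSpace G]

/-- The Følner condition, in the form used for transference. -/
theorem exists_foelner_pair {K : Set G} (hK : IsCompact K) {r : ℝ≥0} (hr : 1 < r) :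
    ∃ V O : Set G, IsCompact V ∧ IsOpen O ∧ V - K ⊆ O ∧ ν V ≠ 0 ∧ ν O ≠ ∞ ∧ ν O ≤ r * ν V := by
  obtain ⟨U, hU, hU0⟩ := exists_compact_mem_nhds (0 : G)
  set L := U ∪ -K
  have hL : IsCompact L := hU.union hK.neg
  have hL0 : L ∈ 𝓝 (0 : G) := Filter.mem_of_superset hU0 subset_union_left
  obtain ⟨n, hn⟩ := exists_measure_add_two_nsmul_le ν hL hL0 hr
  have hO : (n + 2) • L + interior L ⊆ (n + 3) • L := by
    rw [succ_nsmul L (n + 2)]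
    exact add_subset_add_left interior_subset
  refine ⟨(n + 1) • L, (n + 2) • L + interior L, isCompact_succ_nsmul hL n,
    isOpen_interior.add_left, ?_, ?_, ?_, (measure_mono hO).trans hn⟩
  · rw [sub_eq_add_neg]
    intro x hx
    refine ⟨x, ?_, 0, mem_interior_iff_mem_nhds.2 hL0, add_zero x⟩
    rw [succ_nsmul L (n + 1)]
    exact add_subset_add_left subset_union_right hx
  · refine fun h => (Measure.measure_pos_of_mem_nhds ν hL0).ne' (measure_mono_null ?_ h)
    intro x hx
    rw [succ_nsmul]
    exact ⟨0, zero_mem_nsmul (mem_of_mem_nhds hL0), x, hx, zero_add x⟩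
  · exact ((measure_mono hO).trans_lt (isCompact_succ_nsmul hL (n + 2)).measure_lt_top).ne

end Foelner

/-! ### Square functions as Euclidean norms -/

section SquareFunction

variable {α J 𝕜 : Type*} [RCLike 𝕜]

theorem squareFunction_eq_enorm_toLp [Fintype J] (F : J → α → 𝕜) (x : α) :
    squareFunction F x = ‖(WithLp.toLp 2 fun j => F j x : EuclideanSpace 𝕜 J)‖ₑ := by
  rw [← edist_zero_right, PiLp.edist_eq_sum (by norm_num), squareFunction, tsum_fintype]
  simp

theorem eLpNorm_squareFunction_eq [Fintype J] {m : MeasurableSpace α} (F : J → α → 𝕜)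
    (p : ℝ≥0∞) (μ : Measure α) :
    eLpNorm (squareFunction F) p μ =
      eLpNorm (fun x => (WithLp.toLp 2 fun j => F j x : EuclideanSpace 𝕜 J)) p μ :=
  eLpNorm_congr_enorm_ae (.of_forall fun x => by
    simp [squareFunction_eq_enorm_toLp, enorm_eq_self])

theorem squareFunction_comp_le {J' : Type*} {e : J' → J} (he : Function.Injective e)
    (F : J → α → 𝕜) (x : α) : squareFunction (fun j => F (e j)) x ≤ squareFunction F x :=
  ENNReal.rpow_le_rpow (ENNReal.tsum_comp_le_tsum_of_injective he _) (by norm_num)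

theorem eLpNorm_rpow_toReal {ε : Type*} [ENorm ε] {m : MeasurableSpace α} {p : ℝ≥0∞}
    (hp0 : p ≠ 0) (hp : p ≠ ∞) (f : α → ε) (μ : Measure α) :
    eLpNorm f p μ ^ p.toReal = ∫⁻ x, ‖f x‖ₑ ^ p.toReal ∂μ := by
  lift p to ℝ≥0 using hp
  exact eLpNorm_nnreal_pow_eq_lintegral (by simpa using hp0)

theorem eLpNorm_squareFunction_le_add [Fintype J] {m : MeasurableSpace α} {p : ℝ≥0∞}
    (hp : 1 ≤ p) {μ : Measure α} {F H : J → α → 𝕜} (hF : ∀ j, AEStronglyMeasurable (F j) μ)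
    (hH : ∀ j, AEStronglyMeasurable (H j) μ) :
    eLpNorm (squareFunction F) p μ ≤
      eLpNorm (squareFunction H) p μ + ∑ j, eLpNorm (F j - H j) p μ := by
  classical
  have hmeas : ∀ {F : J → α → 𝕜}, (∀ j, AEStronglyMeasurable (F j) μ) →
      AEStronglyMeasurable (fun x => (WithLp.toLp 2 fun j => F j x : EuclideanSpace 𝕜 J)) μ := by
    intro F hF
    exact (PiLp.continuous_toLp 2 _).comp_aestronglyMeasurable
      (aemeasurable_pi_lambda _ fun j => (hF j).aemeasurable).aestronglyMeasurable
  have hsum : (fun x => (WithLp.toLp 2 fun j => F j x : EuclideanSpace 𝕜 J)) =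
      (fun x => (WithLp.toLp 2 fun j => H j x : EuclideanSpace 𝕜 J)) +
        ∑ j, fun x => EuclideanSpace.single j (F j x - H j x) := by
    ext x i
    simp [Finset.sum_apply, Pi.single_apply]
  rw [eLpNorm_squareFunction_eq, eLpNorm_squareFunction_eq, hsum]
  have hs : ∀ j, AEStronglyMeasurable
      (fun x => (EuclideanSpace.single j (F j x - H j x) : EuclideanSpace 𝕜 J)) μ := by
    intro j
    have : Continuous fun a : 𝕜 => (EuclideanSpace.single j a : EuclideanSpace 𝕜 J) :=
      (PiLp.continuous_toLp 2 _).comp (continuous_single (A := fun _ : J => 𝕜) j)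
    exact this.comp_aestronglyMeasurable ((hF j).sub (hH j))
  refine (eLpNorm_add_le (hmeas hH) (Finset.aestronglyMeasurable_sum _ fun j _ => hs j) hp).trans ?_
  gcongr
  refine (eLpNorm_sum_le (fun j _ => hs j) hp).trans (Finset.sum_le_sum fun j _ => ?_)
  refine (eLpNorm_congr_norm_ae (.of_forall fun x => ?_)).le
  simp

end SquareFunction

/-! ### Exchanging integrals over a measure that need not be σ-finite -/

section Swap

variable {Ω J Z 𝕜 : Type*} [RCLike 𝕜] [MeasurableSpace Ω] {μ : Measure Ω} [MeasurableSpace Z]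

/-- Tonelli's theorem for functions of finitely many elements of `L^p(μ)`, `p < ∞`, and a
parameter. No σ-finiteness of `μ` is needed, as these elements vanish off a σ-finite set. -/
theorem lintegral_lintegral_swap_of_memLp [Finite J] {ρ : Measure Z} [SFinite ρ] {p : ℝ≥0∞}
    (hp0 : p ≠ 0) (hp : p ≠ ∞) {g : J → Ω → 𝕜} (hg : ∀ j, MemLp (g j) p μ)
    {Φ : (J → 𝕜) → Z → ℝ≥0∞} (hΦ : Measurable (Function.uncurry Φ)) (hΦ0 : ∀ z, Φ 0 z = 0) :
    ∫⁻ z, ∫⁻ x, Φ (fun j => g j x) z ∂μ ∂ρ = ∫⁻ x, ∫⁻ z, Φ (fun j => g j x) z ∂ρ ∂μ := by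
  have := Fintype.ofFinite J
  have hh : MemLp (fun x => ∑ j, ‖g j x‖) p μ := memLp_finsetSum _ fun j _ => (hg j).norm
  obtain ⟨h', hh', hae⟩ := hh.aefinStronglyMeasurable hp0 hp
  obtain ⟨t, ht, ht0, hσ⟩ := hh'.exists_set_sigmaFinite
  have hvan : ∀ᵐ x ∂μ, x ∉ t → (fun j => g j x) = 0 := by
    filter_upwards [hae] with x hx hxt
    rw [ht0 x hxt, Finset.sum_eq_zero_iff_of_nonneg fun j _ => norm_nonneg _] at hx
    funext j
    simpa using hx j (Finset.mem_univ j)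
  have hgt : AEMeasurable (fun x j => g j x) (μ.restrict t) :=
    aemeasurable_pi_lambda _ fun j => (hg j).1.aemeasurable.restrict
  have hl : ∀ z, ∫⁻ x, Φ (fun j => g j x) z ∂μ = ∫⁻ x in t, Φ (fun j => g j x) z ∂μ := by
    intro z
    rw [← lintegral_indicator ht]
    refine lintegral_congr_ae ?_
    filter_upwards [hvan] with x hx
    by_cases hxt : x ∈ t
    · simp [hxt]
    · simp [hxt, hx hxt, hΦ0]
  have hr : ∫⁻ x, ∫⁻ z, Φ (fun j => g j x) z ∂ρ ∂μ =
      ∫⁻ x in t, ∫⁻ z, Φ (fun j => g j x) z ∂ρ ∂μ := by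
    rw [← lintegral_indicator ht]
    refine lintegral_congr_ae ?_
    filter_upwards [hvan] with x hx
    by_cases hxt : x ∈ t
    · simp [hxt]
    · simp [hxt, hx hxt, hΦ0]
  simp_rw [hl, hr]
  refine lintegral_lintegral_swap ?_
  have h2 : AEMeasurable (fun q : Z × Ω => fun j => g j q.2) (ρ.prod (μ.restrict t)) :=
    hgt.comp_snd
  exact hΦ.comp_aemeasurable (h2.prodMk measurable_fst.aemeasurable)

end Swap

/-! ### The Marcinkiewicz–Zygmund inequality with constant one -/

section MarcinkiewiczZygmund

open Module

variable {𝕜 : Type*} [RCLike 𝕜]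

theorem exists_linearIsometryEquiv_apply_eq {E : Type*} [NormedAddCommGroup E]
    [InnerProductSpace 𝕜 E] [FiniteDimensional 𝕜 E] {a b : E} (ha : ‖a‖ = 1) (hb : ‖b‖ = 1) :
    ∃ U : E ≃ₗᵢ[𝕜] E, U a = b := by
  let L : Submodule.span 𝕜 {a} →ₗᵢ[𝕜] E := (LinearIsometry.toSpanSingleton 𝕜 E hb).comp
    (LinearIsometryEquiv.toSpanUnitSingleton (𝕜 := 𝕜) a ha).symm.toLinearIsometry
  refine ⟨L.extend.toLinearIsometryEquiv rfl, ?_⟩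
  have h := L.extend_apply ⟨a, Submodule.mem_span_singleton_self a⟩
  have h1 : (⟨a, Submodule.mem_span_singleton_self a⟩ : Submodule.span 𝕜 {a}) =
      LinearIsometryEquiv.toSpanUnitSingleton (𝕜 := 𝕜) a ha 1 := by
    ext; simp
  rw [LinearIsometry.coe_toLinearIsometryEquiv]
  refine h.trans ?_
  rw [h1]
  change (LinearIsometryEquiv.toSpanUnitSingleton (𝕜 := 𝕜) a ha).symm _ • b = b
  rw [LinearIsometryEquiv.symm_apply_apply, one_smul]

/-- There is a finite measure on a finite-dimensional inner product space for which every linear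
functional `⟪·, a⟫` has `L^q` norm proportional to `‖a‖`. Any nonzero finite measure that is
invariant under unitary maps and has a `q`-th moment will do; Lebesgue measure on the unit ball is
taken here. -/
theorem exists_measure_lintegral_inner_rpow_eq (E : Type*) [NormedAddCommGroup E]
    [InnerProductSpace 𝕜 E] [FiniteDimensional 𝕜 E] [MeasurableSpace E] [BorelSpace E]
    {q : ℝ} (hq : 0 < q) :
    ∃ (ρ : Measure E) (A : ℝ≥0∞), IsFiniteMeasure ρ ∧ A ≠ 0 ∧ A ≠ ∞ ∧
      ∀ a : E, ∫⁻ z, ‖inner 𝕜 z a‖ₑ ^ q ∂ρ = A * ‖a‖ₑ ^ q := by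
  rcases subsingleton_or_nontrivial E with hE | hE
  · refine ⟨0, 1, inferInstance, one_ne_zero, ENNReal.one_ne_top, fun a => ?_⟩
    have : a = 0 := Subsingleton.elim _ _
    simp [this, hq]
  let _ : InnerProductSpace ℝ E := InnerProductSpace.rclikeToReal 𝕜 E
  have : IsScalarTower ℝ 𝕜 E := IsScalarTower.of_algebraMap_smul fun _ _ => rfl
  have : FiniteDimensional ℝ E := FiniteDimensional.trans ℝ 𝕜 E
  let vol : Measure E := (measureSpaceOfInnerProductSpace (E := E)).volume
  have hvol : vol.IsAddHaarMeasure := by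
    change Measure.IsAddHaarMeasure (volume : Measure E)
    infer_instance
  let B : Set E := Metric.ball 0 1
  have hmeas : ∀ a : E, Measurable fun z : E => ‖inner 𝕜 z a‖ₑ ^ q := fun a =>
    (Continuous.inner (𝕜 := 𝕜) continuous_id continuous_const).enorm.measurable.pow_const q
  have hinv : ∀ (U : E ≃ₗᵢ[𝕜] E) (a : E),
      ∫⁻ z in B, ‖inner 𝕜 z (U a)‖ₑ ^ q ∂vol = ∫⁻ z in B, ‖inner 𝕜 z a‖ₑ ^ q ∂vol := by
    intro U a
    let U' : E ≃ₗᵢ[ℝ] E := ⟨U.toLinearEquiv.restrictScalars ℝ, U.norm_map⟩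
    have hU : MeasurePreserving U' (vol.restrict B) (vol.restrict B) := by
      have h := U'.measurePreserving.restrict_preimage (s := B) Metric.isOpen_ball.measurableSet
      have hB : U' ⁻¹' B = B := by
        ext z
        simp [B]
      rwa [hB] at h
    rw [← hU.lintegral_comp (hmeas (U a))]
    refine lintegral_congr fun z => ?_
    change ‖inner 𝕜 (U z) (U a)‖ₑ ^ q = _
    rw [U.inner_map_map]
  obtain ⟨e₀, he₀⟩ := exists_ne (0 : E)
  obtain ⟨e, he⟩ : ∃ e : E, ‖e‖ = 1 := ⟨(‖e₀‖ : 𝕜)⁻¹ • e₀, norm_smul_inv_norm he₀⟩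
  have hBtop : vol B < ∞ := measure_ball_lt_top
  refine ⟨vol.restrict B, ∫⁻ z in B, ‖inner 𝕜 z e‖ₑ ^ q ∂vol, ⟨by simpa using hBtop⟩, ?_, ?_, ?_⟩
  · refine ((setLIntegral_pos_iff (hmeas e)).2 ?_).ne'
    have hcont : Continuous fun z : E => ‖inner 𝕜 z e‖ :=
      (Continuous.inner (𝕜 := 𝕜) continuous_id continuous_const).norm
    have hopen : IsOpen ({z : E | 0 < ‖inner 𝕜 z e‖} ∩ B) :=
      (isOpen_lt continuous_const hcont).inter Metric.isOpen_ball
    refine (hopen.measure_pos vol ⟨(2⁻¹ : 𝕜) • e, ?_, ?_⟩).trans_le (measure_mono ?_)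
    · simp [inner_smul_left, he]
    · simp only [B, Metric.mem_ball, dist_zero_right, norm_smul, he]
      norm_num
    · refine Set.inter_subset_inter_left _ fun z hz => ?_
      have hz' : inner 𝕜 z e ≠ 0 := by simpa using hz
      simp [Function.mem_support, hz']
  · refine ((setLIntegral_mono measurable_const (g := fun _ => 1) fun z hz => ?_).trans_lt ?_).ne
    · have h1 : ‖inner 𝕜 z e‖ ≤ 1 := (norm_inner_le_norm z e).trans (by
        rw [he, mul_one]; simpa [B] using (Metric.mem_ball.1 hz).le)
      refine ENNReal.rpow_le_one ?_ hq.le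
      rw [← ofReal_norm]
      simpa using ENNReal.ofReal_le_ofReal h1
    · simpa using hBtop
  · intro a
    rcases eq_or_ne a 0 with rfl | ha
    · simp [hq]
    have hna : (‖a‖ : 𝕜) ≠ 0 := by simpa using ha
    let b : E := (‖a‖ : 𝕜)⁻¹ • a
    have hb : ‖b‖ = 1 := norm_smul_inv_norm ha
    obtain ⟨U, hU⟩ := exists_linearIsometryEquiv_apply_eq (𝕜 := 𝕜) he hb
    have hab : a = (‖a‖ : 𝕜) • b := by simp only [b]; rw [smul_inv_smul₀ hna]
    have hna' : ‖(‖a‖ : 𝕜)‖ₑ = ‖a‖ₑ := by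
      rw [← ofReal_norm, ← ofReal_norm]; simp
    conv_lhs => rw [hab]
    simp_rw [inner_smul_right, enorm_mul, ENNReal.mul_rpow_of_nonneg _ _ hq.le]
    rw [lintegral_const_mul _ (hmeas b), ← hU, hinv, hna', mul_comm]

variable {J : Type*} [Fintype J] {Ω : Type*} [MeasurableSpace Ω] {μ : Measure Ω} {p : ℝ≥0∞} [Fact (1 ≤ p)]

theorem lintegral_eLpNorm_inner_eq (hp : p ≠ ∞) {ρ : Measure (EuclideanSpace 𝕜 J)}
    [IsFiniteMeasure ρ] {A : ℝ≥0∞} (hA1 : A ≠ ∞)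
    (hA : ∀ a : EuclideanSpace 𝕜 J, ∫⁻ z, ‖inner 𝕜 z a‖ₑ ^ p.toReal ∂ρ = A * ‖a‖ₑ ^ p.toReal)
    (g : J → Lp 𝕜 p μ) :
    ∫⁻ z, ‖∑ j, star (z j) • g j‖ₑ ^ p.toReal ∂ρ =
      A * eLpNorm (squareFunction fun j => ⇑(g j)) p μ ^ p.toReal := by
  have hp0 : p ≠ 0 := (one_pos.trans_le Fact.out).ne'
  have hq : 0 < p.toReal := ENNReal.toReal_pos hp0 hp
  let Φ : (J → 𝕜) → EuclideanSpace 𝕜 J → ℝ≥0∞ := fun a z =>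
    ‖inner 𝕜 z (WithLp.toLp 2 a : EuclideanSpace 𝕜 J)‖ₑ ^ p.toReal
  have hΦ : Measurable (Function.uncurry Φ) := by
    have : Continuous fun y : (J → 𝕜) × EuclideanSpace 𝕜 J =>
        inner 𝕜 y.2 (WithLp.toLp 2 y.1 : EuclideanSpace 𝕜 J) :=
      continuous_snd.inner ((PiLp.continuous_toLp 2 _).comp continuous_fst)
    exact this.enorm.measurable.pow_const _
  have hΦ0 : ∀ z, Φ 0 z = 0 := fun z => by simp [Φ, hq]
  have hswap := lintegral_lintegral_swap_of_memLp (ρ := ρ) hp0 hp (fun j => Lp.memLp (g j)) hΦ hΦ0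
  have hl : ∀ z : EuclideanSpace 𝕜 J, ‖∑ j, star (z j) • g j‖ₑ ^ p.toReal =
      ∫⁻ x, Φ (fun j => g j x) z ∂μ := by
    intro z
    rw [Lp.enorm_def, eLpNorm_rpow_toReal hp0 hp]
    refine lintegral_congr_ae ?_
    filter_upwards [Lp.coeFn_fun_finsetSum Finset.univ fun j => star (z j) • g j,
      ae_all_iff.2 fun j => Lp.coeFn_smul (star (z j)) (g j)] with x hx hx'
    simp only [hx, hx', Φ, EuclideanSpace.inner_eq_star_dotProduct, dotProduct, Pi.smul_apply,
      smul_eq_mul, Pi.star_apply, mul_comm]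
  simp_rw [hl, hswap, Φ, hA]
  rw [eLpNorm_rpow_toReal hp0 hp, lintegral_const_mul' _ _ hA1]
  simp only [squareFunction_eq_enorm_toLp, enorm_eq_self]

/-- **Marcinkiewicz–Zygmund**: a bounded operator on `L^p` extends to `ℓ²`-valued functions
with the same norm. -/
theorem eLpNorm_squareFunction_clm_le (hp : p ≠ ∞) (S : Lp 𝕜 p μ →L[𝕜] Lp 𝕜 p μ)
    (g : J → Lp 𝕜 p μ) :
    eLpNorm (squareFunction fun j => ⇑(S (g j))) p μ ≤
      ‖S‖ₑ * eLpNorm (squareFunction fun j => ⇑(g j)) p μ := by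
  have hp0 : p ≠ 0 := (one_pos.trans_le Fact.out).ne'
  have hq : 0 < p.toReal := ENNReal.toReal_pos hp0 hp
  obtain ⟨ρ, A, hρ, hA0, hA1, hA⟩ := exists_measure_lintegral_inner_rpow_eq (𝕜 := 𝕜) (EuclideanSpace 𝕜 J) hq
  rw [← ENNReal.rpow_le_rpow_iff hq, ENNReal.mul_rpow_of_nonneg _ _ hq.le,
    ← ENNReal.mul_le_mul_iff_right hA0 hA1, ← lintegral_eLpNorm_inner_eq hp hA1 hA,
    mul_left_comm, ← lintegral_eLpNorm_inner_eq hp hA1 hA, ← lintegral_const_mul' _ _ (by simp [hq.le])]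
  refine lintegral_mono fun z => ?_
  rw [← ENNReal.mul_rpow_of_nonneg _ _ hq.le]
  refine ENNReal.rpow_le_rpow ?_ hq.le
  simpa only [map_sum, map_smul] using S.le_opENorm (∑ j, star (z j) • g j)

end MarcinkiewiczZygmund

/-! ### Convolution of an integrable kernel with a bounded continuous vector-valued function -/

section Convolution

open Set
open scoped Topology

theorem exists_isCompact_lintegral_compl_lt {X : Type*} [TopologicalSpace X] [T2Space X]
    [MeasurableSpace X] [BorelSpace X] {ν : Measure X} [ν.Regular] {f : X → ℝ≥0∞}
    (hf : ∫⁻ x, f x ∂ν ≠ ∞) {ε : ℝ≥0∞} (hε : ε ≠ 0) :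
    ∃ K : Set X, IsCompact K ∧ ∫⁻ x in Kᶜ, f x ∂ν < ε := by
  have hε2 : ε / 2 ≠ 0 := by simpa using hε
  obtain ⟨s, hs, hsfin, hsε⟩ := exists_setLIntegral_compl_lt hf hε2
  obtain ⟨δ, hδ, hδε⟩ := exists_pos_setLIntegral_lt_of_measure_lt hf hε2
  obtain ⟨K, hKs, hK, hKδ⟩ := hs.exists_isCompact_sdiff_lt hsfin.ne hδ.ne'
  refine ⟨K, hK, ?_⟩
  have hsub : Kᶜ ⊆ sᶜ ∪ s \ K := by
    intro x hx
    by_cases hxs : x ∈ s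
    · exact Or.inr ⟨hxs, hx⟩
    · exact Or.inl hxs
  calc ∫⁻ x in Kᶜ, f x ∂ν ≤ ∫⁻ x in sᶜ ∪ s \ K, f x ∂ν := lintegral_mono_set hsub
    _ ≤ ∫⁻ x in sᶜ, f x ∂ν + ∫⁻ x in s \ K, f x ∂ν := lintegral_union_le _ _ _
    _ < ε / 2 + ε / 2 := ENNReal.add_lt_add hsε (hδε _ hKδ)
    _ = ε := ENNReal.add_halves ε

theorem exists_isCompact_forall_lintegral_compl_le {X J : Type*} [Finite J] [TopologicalSpace X]
    [T2Space X] [MeasurableSpace X] [BorelSpace X] {ν : Measure X} [ν.Regular]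
    {f : J → X → ℝ≥0∞} (hf : ∀ j, ∫⁻ x, f j x ∂ν ≠ ∞) {ε : ℝ≥0∞} (hε : ε ≠ 0) :
    ∃ K : Set X, IsCompact K ∧ ∀ j, ∫⁻ x in Kᶜ, f j x ∂ν ≤ ε := by
  choose K hK hKε using fun j => exists_isCompact_lintegral_compl_lt (hf j) hε
  exact ⟨⋃ j, K j, isCompact_iUnion hK, fun j =>
    (lintegral_mono_set (compl_subset_compl.2 (subset_iUnion K j))).trans (hKε j).le⟩

variable {𝕜 E : Type*} [RCLike 𝕜] [NormedAddCommGroup E] [NormedSpace 𝕜 E]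

/-- The space `X` need not be second countable, so `F` itself may fail to be strongly measurable;
but an integrable `k` vanishes almost everywhere off a σ-compact set. -/
theorem integrable_smul_of_continuous_of_bounded {X : Type*} [TopologicalSpace X]
    [T2Space X] [MeasurableSpace X] [BorelSpace X] {ν : Measure X} [ν.Regular] {k : X → 𝕜}
    (hk : Integrable k ν) {F : X → E} (hF : Continuous F) {M : ℝ} (hM : ∀ x, ‖F x‖ ≤ M) :
    Integrable (fun x => k x • F x) ν := by
  choose K hK hKε using fun n : ℕ => exists_isCompact_lintegral_compl_lt
    (f := fun x => ‖k x‖ₑ) hk.2.ne (ε := ((n : ℝ≥0∞) + 1)⁻¹) (by simp)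
  set A : Set X := ⋃ n, K n
  have hAm : MeasurableSet A := .iUnion fun n => (hK n).measurableSet
  have hzero : ∫⁻ x in Aᶜ, ‖k x‖ₑ ∂ν = 0 := by
    refine le_antisymm (ENNReal.le_of_forall_pos_le_add fun ε hε _ => ?_) bot_le
    obtain ⟨n, hn⟩ := ENNReal.exists_inv_nat_lt (a := (ε : ℝ≥0∞)) (by simpa using hε.ne')
    calc ∫⁻ x in Aᶜ, ‖k x‖ₑ ∂ν ≤ ∫⁻ x in (K n)ᶜ, ‖k x‖ₑ ∂ν :=
          lintegral_mono_set (compl_subset_compl.2 (subset_iUnion K n))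
      _ ≤ ((n : ℝ≥0∞) + 1)⁻¹ := (hKε n).le
      _ ≤ (n : ℝ≥0∞)⁻¹ := ENNReal.inv_le_inv.2 le_self_add
      _ ≤ 0 + ε := by simpa using hn.le
  have hae : ∀ᵐ x ∂ν, x ∉ A → k x = 0 := by
    rw [lintegral_eq_zero_iff' hk.1.enorm.restrict] at hzero
    filter_upwards [(ae_restrict_iff' hAm.compl).1 hzero] with x hx hxA
    simpa using hx hxA
  have hFA : AEStronglyMeasurable F (ν.restrict A) :=
    aestronglyMeasurable_iUnion_iff.2 fun n =>
      hF.continuousOn.aestronglyMeasurable_of_isCompact (hK n) (hK n).measurableSet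
  have hmeas : AEStronglyMeasurable (fun x => k x • F x) ν := by
    have h := (aestronglyMeasurable_indicator_iff hAm).2 (hk.1.restrict.smul hFA)
    refine h.congr ?_
    filter_upwards [hae] with x hx
    by_cases hxA : x ∈ A
    · simp [hxA]
    · simp [hxA, hx hxA]
  refine (hk.norm.mul_const M).mono' hmeas (.of_forall fun x => ?_)
  rw [norm_smul]
  exact mul_le_mul_of_nonneg_left (hM x) (norm_nonneg _)

/-- A continuous function is uniformly approximated on a compact set `W` by finite sums
`∑ i, φ i • F (w i)` with a subpartition of unity `φ` that vanishes off a given neighbourhood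
of `W`. -/
theorem exists_subpartition_norm_sub_sum_le {X : Type*} [TopologicalSpace X]
    [T2Space X] [LocallyCompactSpace X] {W O : Set X} (hW : IsCompact W) (hO : IsOpen O)
    (hWO : W ⊆ O) {F : X → E} (hF : Continuous F) {ε : ℝ} (hε : 0 < ε) :
    ∃ (n : ℕ) (φ : Fin n → X → ℝ) (w : Fin n → X), (∀ i, Continuous (φ i)) ∧
      (∀ i, HasCompactSupport (φ i)) ∧ (∀ i x, 0 ≤ φ i x) ∧ (∀ x, ∑ i, φ i x ≤ 1) ∧
      (∀ i, ∀ x ∉ O, φ i x = 0) ∧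
      ∀ x ∈ W, ‖F x - ∑ i, (φ i x : 𝕜) • F (w i)‖ ≤ ε := by
  let U : X → Set X := fun w => O ∩ {x | ‖F x - F w‖ < ε}
  have hU : ∀ w, IsOpen (U w) := fun w =>
    hO.inter (isOpen_lt (hF.sub continuous_const).norm continuous_const)
  obtain ⟨t, ht⟩ := hW.elim_finite_subcover U hU fun x hx =>
    mem_iUnion.2 ⟨x, hWO hx, by simpa using hε⟩
  let w : Fin t.card → X := fun i => (t.equivFin.symm i : X)
  have hcov : W ⊆ ⋃ i, U (w i) := by
    intro x hx
    obtain ⟨y, hy, hxy⟩ := mem_iUnion₂.1 (ht hx)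
    exact mem_iUnion.2 ⟨t.equivFin ⟨y, hy⟩, by simpa [w] using hxy⟩
  obtain ⟨f, hfU, hf1, hf01, hfc⟩ :=
    exists_continuous_sum_one_of_isOpen_isCompact (fun i => hU (w i)) hW hcov
  -- Off `W` the sum of the `f i` may exceed one; dividing by `max 1 (∑ f)` repairs this.
  let s : X → ℝ := fun x => ∑ i, f i x
  have hs : Continuous s := continuous_finsetSum _ fun i _ => (f i).continuous
  have hpos : ∀ x, 0 < max 1 (s x) := fun x => one_pos.trans_le (le_max_left _ _)
  have hs1 : ∀ x ∈ W, s x = 1 := fun x hx => by simpa [s] using hf1 hx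
  have hvan : ∀ i, ∀ x ∉ U (w i), f i x = 0 := fun i x hx =>
    image_eq_zero_of_notMem_tsupport fun h => hx (hfU i h)
  refine ⟨t.card, fun i x => f i x / max 1 (s x), w, fun i => ?_, fun i => ?_, fun i x => ?_,
    fun x => ?_, fun i x hx => ?_, fun x hx => ?_⟩
  · exact (f i).continuous.div (continuous_const.max hs) fun x => (hpos x).ne'
  · refine (hfc i).mono fun x hx h => hx ?_
    simp [h]
  · exact div_nonneg (hf01 i x).1 (hpos x).le
  · rw [← Finset.sum_div, div_le_one (hpos x)]
    exact le_max_right _ _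
  · simp [hvan i x fun h => hx h.1]
  · have hsum : ∑ i, (f i x : 𝕜) = 1 := by
      rw [← RCLike.ofReal_sum]
      simpa [s] using congrArg (RCLike.ofReal (K := 𝕜)) (hs1 x hx)
    have hrw : F x - ∑ i, ((f i x / max 1 (s x) : ℝ) : 𝕜) • F (w i) =
        ∑ i, (f i x : 𝕜) • (F x - F (w i)) := by
      simp only [hs1 x hx, max_self, div_one, smul_sub, Finset.sum_sub_distrib,
        ← Finset.sum_smul, hsum, one_smul]
    rw [hrw]
    calc ‖∑ i, (f i x : 𝕜) • (F x - F (w i))‖ ≤ ∑ i, f i x * ε := by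
          refine norm_sum_le_of_le _ fun i _ => ?_
          rw [norm_smul, RCLike.norm_ofReal, abs_of_nonneg (hf01 i x).1]
          by_cases hxi : x ∈ U (w i)
          · exact mul_le_mul_of_nonneg_left hxi.2.le (hf01 i x).1
          · simp [hvan i x hxi]
      _ = ε := by rw [← Finset.sum_mul]; exact (congrArg (· * ε) (hs1 x hx)).trans (one_mul ε)

theorem norm_sum_smul_le {n : ℕ} {a : Fin n → ℝ} (h0 : ∀ i, 0 ≤ a i) (h1 : ∑ i, a i ≤ 1)
    {g : Fin n → E} {M : ℝ} (hM0 : 0 ≤ M) (hM : ∀ i, ‖g i‖ ≤ M) : ‖∑ i, (a i : 𝕜) • g i‖ ≤ M :=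
  calc ‖∑ i, (a i : 𝕜) • g i‖ ≤ ∑ i, a i * M := norm_sum_le_of_le _ fun i _ => by
        rw [norm_smul, RCLike.norm_ofReal, abs_of_nonneg (h0 i)]
        exact mul_le_mul_of_nonneg_left (hM i) (h0 i)
    _ = (∑ i, a i) * M := (Finset.sum_mul _ _ _).symm
    _ ≤ M := mul_le_of_le_one_left hM0 h1

variable {G : Type*} [AddCommGroup G] [MeasurableSpace G] {ν : Measure G}

theorem scalarConv_apply (k φ : G → 𝕜) (v : G) :
    scalarConv ν k φ v = ∫ u, k u * φ (v - u) ∂ν := rfl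

variable [TopologicalSpace G] [IsTopologicalAddGroup G] [BorelSpace G]

theorem continuous_scalarConv {k φ : G → 𝕜} (hk : Integrable k ν) (hφ : Continuous φ)
    (hφc : HasCompactSupport φ) : Continuous (scalarConv ν k φ) :=
  hφc.continuous_convolution_right _ hk.locallyIntegrable hφ

variable [T2Space G] [ν.Regular]

theorem integrable_mul_comp_sub {k φ : G → 𝕜} (hk : Integrable k ν) (hφ : Continuous φ)
    (hφc : HasCompactSupport φ) (v : G) : Integrable (fun u => k u * φ (v - u)) ν := by
  obtain ⟨C, hC⟩ := hφ.bounded_above_of_compact_support hφc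
  exact integrable_smul_of_continuous_of_bounded hk (hφ.comp (continuous_const.sub continuous_id))
    fun u => hC (v - u)

theorem scalarConv_sum_mul {n : ℕ} {k : G → 𝕜} (hk : Integrable k ν) {φ : Fin n → G → 𝕜}
    (hφ : ∀ i, Continuous (φ i)) (hφc : ∀ i, HasCompactSupport (φ i)) (a : Fin n → 𝕜) (v : G) :
    scalarConv ν k (fun w => ∑ i, φ i w * a i) v = ∑ i, scalarConv ν k (φ i) v * a i := by
  simp only [scalarConv_apply, Finset.mul_sum, ← mul_assoc]
  rw [integral_finsetSum _ fun i _ => (integrable_mul_comp_sub hk (hφ i) (hφc i) v).mul_const _]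
  simp only [integral_mul_const]

variable [NormedSpace ℝ E] [CompleteSpace E]

/-- If `F` is within `ε` of `∑ i, φ i • g i` on `v - K`, and both are bounded by `M`, then
`∫ k(u) F(v - u) du` is close to `∑ i, (k * φ i)(v) • g i`. -/
theorem enorm_integral_smul_sub_sum_scalarConv_le {k : G → 𝕜} (hk : Integrable k ν) {F : G → E}
    (hF : Continuous F) {M : ℝ≥0} (hM : ∀ u, ‖F u‖ ≤ M) {n : ℕ} {φ : Fin n → G → ℝ}
    (hφ : ∀ i, Continuous (φ i)) (hφc : ∀ i, HasCompactSupport (φ i)) (hφ0 : ∀ i u, 0 ≤ φ i u)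
    (hφ1 : ∀ u, ∑ i, φ i u ≤ 1) {g : Fin n → E} (hg : ∀ i, ‖g i‖ ≤ M) {K : Set G}
    (hK : MeasurableSet K) {ε : ℝ≥0} {v : G}
    (hε : ∀ u ∈ K, ‖F (v - u) - ∑ i, (φ i (v - u) : 𝕜) • g i‖ ≤ ε) :
    ‖∫ u, k u • F (v - u) ∂ν - ∑ i, scalarConv ν k (fun w => (φ i w : 𝕜)) v • g i‖ₑ ≤
      ε * ∫⁻ u, ‖k u‖ₑ ∂ν + 2 * M * ∫⁻ u in Kᶜ, ‖k u‖ₑ ∂ν := by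
  have hφ' : ∀ i, Continuous fun w => (φ i w : 𝕜) := fun i => RCLike.continuous_ofReal.comp (hφ i)
  have hφc' : ∀ i, HasCompactSupport fun w => (φ i w : 𝕜) := fun i =>
    (hφc i).comp_left (g := fun r : ℝ => (r : 𝕜)) (by simp)
  have hconv : ∑ i, scalarConv ν k (fun w => (φ i w : 𝕜)) v • g i =
      ∫ u, k u • ∑ i, (φ i (v - u) : 𝕜) • g i ∂ν := by
    simp only [scalarConv_apply, Finset.smul_sum, smul_smul, ← integral_smul_const]
    exact (integral_finsetSum _ fun i _ =>
      (integrable_mul_comp_sub hk (hφ' i) (hφc' i) v).smul_const _).symm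
  have hcs : Continuous fun u : G => v - u := continuous_const.sub continuous_id
  have hi1 : Integrable (fun u => k u • F (v - u)) ν :=
    integrable_smul_of_continuous_of_bounded hk (hF.comp hcs) fun u => hM (v - u)
  have hi2 : Integrable (fun u => k u • ∑ i, (φ i (v - u) : 𝕜) • g i) ν :=
    integrable_smul_of_continuous_of_bounded hk
      (continuous_finsetSum _ fun i _ => ((hφ' i).comp hcs).smul continuous_const)
      fun u => norm_sum_smul_le (fun i => hφ0 i (v - u)) (hφ1 (v - u)) M.coe_nonneg hg
  rw [hconv, ← integral_sub hi1 hi2]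
  refine (enorm_integral_le_lintegral_enorm _).trans ?_
  rw [← lintegral_add_compl _ hK]
  gcongr
  · calc ∫⁻ u in K, ‖k u • F (v - u) - k u • ∑ i, (φ i (v - u) : 𝕜) • g i‖ₑ ∂ν
        ≤ ∫⁻ u in K, ε * ‖k u‖ₑ ∂ν := by
          refine setLIntegral_mono' hK fun u hu => ?_
          rw [← smul_sub, enorm_smul, mul_comm]
          gcongr
          exact enorm_le_coe.2 (hε u hu)
      _ ≤ ∫⁻ u, ε * ‖k u‖ₑ ∂ν := setLIntegral_le_lintegral _ _
      _ = ε * ∫⁻ u, ‖k u‖ₑ ∂ν := lintegral_const_mul' _ _ ENNReal.coe_ne_top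
  · rw [← lintegral_const_mul' _ _ (by finiteness)]
    refine lintegral_mono fun u => ?_
    rw [← smul_sub, enorm_smul, mul_comm]
    gcongr
    have h : ‖F (v - u) - ∑ i, (φ i (v - u) : 𝕜) • g i‖ ≤ ((2 * M : ℝ≥0) : ℝ) := by
      refine (norm_sub_le_of_le (hM (v - u)) (norm_sum_smul_le (𝕜 := 𝕜) (fun i => hφ0 i (v - u))
        (hφ1 (v - u)) M.coe_nonneg hg)).trans_eq ?_
      push_cast
      ring
    have h' := enorm_le_coe.2 (show ‖F (v - u) - ∑ i, (φ i (v - u) : 𝕜) • g i‖₊ ≤ 2 * M from h)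
    rwa [ENNReal.coe_mul] at h'

end Convolution

/-! ### Countable square functions -/

section CountableSquareFunction

variable {ι α 𝕜 : Type*} [RCLike 𝕜] {m : MeasurableSpace α} {μ : Measure α} {F : ι → α → 𝕜}

theorem squareFunction_eq_iSup_finset (F : ι → α → 𝕜) (x : α) :
    squareFunction F x = ⨆ s : Finset ι, squareFunction (fun j : s => F j) x := by
  simp only [squareFunction, ENNReal.tsum_eq_iSup_sum (f := fun j => ‖F j x‖ₑ ^ 2)]
  rw [← ENNReal.orderIsoRpow_apply _ (by norm_num), OrderIso.map_iSup]
  refine iSup_congr fun s => ?_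
  rw [ENNReal.orderIsoRpow_apply, Finset.tsum_subtype s fun j => ‖F j x‖ₑ ^ 2]

theorem aemeasurable_squareFunction [Countable ι] (hF : ∀ j, AEStronglyMeasurable (F j) μ) :
    AEMeasurable (squareFunction F) μ :=
  (AEMeasurable.tsum fun j => (hF j).enorm.pow_const 2).pow_const _

theorem eLpNorm_squareFunction_le_of_finset [Countable ι]
    (hF : ∀ j, AEStronglyMeasurable (F j) μ) {p : ℝ≥0∞} (hp0 : p ≠ 0) (hp : p ≠ ∞) {C : ℝ≥0∞}
    (h : ∀ s : Finset ι, eLpNorm (squareFunction fun j : s => F j) p μ ≤ C) :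
    eLpNorm (squareFunction F) p μ ≤ C := by
  have hq : 0 < p.toReal := ENNReal.toReal_pos hp0 hp
  have hmono : Monotone fun (s : Finset ι) x => squareFunction (fun j : s => F j) x ^ p.toReal :=
    fun s t hst x => ENNReal.rpow_le_rpow
      (squareFunction_comp_le (e := Set.inclusion hst) (Set.inclusion_injective hst)
        (fun j : t => F j) x) hq.le
  rw [← ENNReal.rpow_le_rpow_iff hq, eLpNorm_rpow_toReal hp0 hp]
  calc ∫⁻ x, ‖squareFunction F x‖ₑ ^ p.toReal ∂μ
      = ∫⁻ x, ⨆ s : Finset ι, squareFunction (fun j : s => F j) x ^ p.toReal ∂μ := by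
        refine lintegral_congr fun x => ?_
        rw [enorm_eq_self, squareFunction_eq_iSup_finset, ← ENNReal.orderIsoRpow_apply _ hq,
          OrderIso.map_iSup]
        rfl
    _ = ⨆ s : Finset ι, ∫⁻ x, squareFunction (fun j : s => F j) x ^ p.toReal ∂μ :=
        lintegral_iSup_directed
          (fun s => (aemeasurable_squareFunction fun j : s => hF j).pow_const _)
          hmono.directed_le
    _ ≤ C ^ p.toReal := iSup_le fun s => by
        have := ENNReal.rpow_le_rpow (h s) hq.le
        simpa only [eLpNorm_rpow_toReal hp0 hp, enorm_eq_self] using this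

end CountableSquareFunction

theorem eLpNorm_squareFunction_scalarConv_le {ι G 𝕜 : Type*} [RCLike 𝕜] [AddCommGroup G]
    [MeasurableSpace G] {ν : Measure G} {p : ℝ≥0∞} {k : ι → G → 𝕜}
    (hN : squareNorm ν p k < ∞) {f : G → 𝕜} (hf : MemLp f p ν) :
    eLpNorm (squareFunction fun j => scalarConv ν (k j) f) p ν ≤
      squareNorm ν p k * eLpNorm f p ν := by
  obtain ⟨C, hC, -⟩ := sInf_lt_iff.1 hN
  rcases eq_or_ne (eLpNorm f p ν) 0 with h0 | h0
  · simpa [h0] using hC f hf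
  · rw [← ENNReal.div_le_iff h0 hf.2.ne]
    exact le_sInf fun C hC => ENNReal.div_le_of_le_mul (hC f hf)

/-! ### Transference -/

section Transference

open scoped Pointwise

variable {𝕜 G Ω J : Type*} [RCLike 𝕜] [Fintype J]
  [AddCommGroup G] [TopologicalSpace G] [IsTopologicalAddGroup G] [T2Space G]
  [MeasurableSpace G] [BorelSpace G] {ν : Measure G} [ν.Regular]
  [MeasurableSpace Ω] {μ : Measure Ω} {p : ℝ≥0∞} [Fact (1 ≤ p)]

/-- The scalar convolution inequality, applied to `v ↦ ∑ i, φ i v * g i x` for every `x` and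
integrated in `x`, gives the same inequality for the `L^p(μ)`-valued function `∑ i, φ i • g i`. -/
theorem lintegral_eLpNorm_squareFunction_sum_scalarConv_le (hp : p ≠ ∞) {k : J → G → 𝕜}
    (hk : ∀ j, Integrable (k j) ν) {N : ℝ≥0}
    (hN : ∀ f : G → 𝕜, MemLp f p ν →
      eLpNorm (squareFunction fun j => scalarConv ν (k j) f) p ν ≤ N * eLpNorm f p ν)
    {n : ℕ} {φ : Fin n → G → ℝ} (hφ : ∀ i, Continuous (φ i)) (hφc : ∀ i, HasCompactSupport (φ i))
    (hφ0 : ∀ i u, 0 ≤ φ i u) (hφ1 : ∀ u, ∑ i, φ i u ≤ 1) {O V : Set G} (hO : MeasurableSet O)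
    (hOtop : ν O ≠ ∞) (hφO : ∀ i, ∀ u ∉ O, φ i u = 0) (hV : ν V ≠ ∞)
    {g : Fin n → Lp 𝕜 p μ} {M : ℝ≥0} (hg : ∀ i, ‖g i‖ ≤ M) :
    ∫⁻ v in V, eLpNorm (squareFunction fun j =>
        ⇑(∑ i, scalarConv ν (k j) (fun w => (φ i w : 𝕜)) v • g i)) p μ ^ p.toReal ∂ν ≤
      (N : ℝ≥0∞) ^ p.toReal * ((M : ℝ≥0∞) ^ p.toReal * ν O) := by
  have hp0 : p ≠ 0 := (one_pos.trans_le Fact.out).ne'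
  have hq : 0 < p.toReal := ENNReal.toReal_pos hp0 hp
  have : IsFiniteMeasure (ν.restrict V) := ⟨by simpa using hV.lt_top⟩
  have : IsFiniteMeasure (ν.restrict O) := ⟨by simpa using hOtop.lt_top⟩
  have hφ' : ∀ i, Continuous fun w => (φ i w : 𝕜) := fun i => RCLike.continuous_ofReal.comp (hφ i)
  have hφc' : ∀ i, HasCompactSupport fun w => (φ i w : 𝕜) := fun i =>
    (hφc i).comp_left (g := fun r : ℝ => (r : 𝕜)) (by simp)
  let Φ : (Fin n → 𝕜) → G → ℝ≥0∞ := fun a v => squareFunction (fun j v =>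
    ∑ i, scalarConv ν (k j) (fun w => (φ i w : 𝕜)) v * a i) v ^ p.toReal
  let Ψ : (Fin n → 𝕜) → G → ℝ≥0∞ := fun a w => ‖∑ i, (φ i w : 𝕜) * a i‖ₑ ^ p.toReal
  have hcoef : ∀ (i : Fin n), Measurable fun y : (Fin n → 𝕜) × G => y.1 i := fun i =>
    (measurable_pi_apply i).comp measurable_fst
  have hΦ : Measurable (Function.uncurry Φ) := by
    have h : ∀ j, Measurable fun y : (Fin n → 𝕜) × G =>
        ∑ i, scalarConv ν (k j) (fun w => (φ i w : 𝕜)) y.2 * y.1 i := fun j =>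
      Finset.measurable_sum _ fun i _ =>
        ((continuous_scalarConv (hk j) (hφ' i) (hφc' i)).measurable.comp measurable_snd).mul
          (hcoef i)
    exact ((Measurable.tsum fun j => (h j).enorm.pow_const 2).pow_const _).pow_const _
  have hΨ : Measurable (Function.uncurry Ψ) :=
    (Finset.measurable_sum _ fun i _ =>
      ((hφ' i).measurable.comp measurable_snd).mul (hcoef i)).enorm.pow_const _
  have hΦ0 : ∀ v, Φ 0 v = 0 := fun v => by simp [Φ, squareFunction, hq]
  have hΨ0 : ∀ v, Ψ 0 v = 0 := fun v => by simp [Ψ, hq]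
  have hcoe : ∀ b : Fin n → 𝕜, ∀ᵐ x ∂μ, (∑ i, b i • g i : Lp 𝕜 p μ) x = ∑ i, b i * g i x := by
    intro b
    filter_upwards [Lp.coeFn_fun_finsetSum Finset.univ fun i => b i • g i,
      ae_all_iff.2 fun i => Lp.coeFn_smul (b i) (g i)] with x hx hx'
    simp only [hx, hx', Pi.smul_apply, smul_eq_mul]
  have hpoint : ∀ a : Fin n → 𝕜,
      ∫⁻ v in V, Φ a v ∂ν ≤ (N : ℝ≥0∞) ^ p.toReal * ∫⁻ w in O, Ψ a w ∂ν := by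
    intro a
    have hfc : HasCompactSupport fun w => ∑ i, (φ i w : 𝕜) * a i :=
      HasCompactSupport.intro (isCompact_iUnion fun i => (hφc' i).isCompact) fun w hw =>
        Finset.sum_eq_zero fun i _ => by
          have h : (φ i w : 𝕜) = 0 := image_eq_zero_of_notMem_tsupport
            (f := fun w => (φ i w : 𝕜)) fun h => hw (Set.mem_iUnion.2 ⟨i, h⟩)
          rw [h, zero_mul]
    have hf : MemLp (fun w => ∑ i, (φ i w : 𝕜) * a i) p ν :=
      (continuous_finsetSum _ fun i _ => (hφ' i).mul continuous_const).memLp_of_hasCompactSupport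
        hfc
    have h := ENNReal.rpow_le_rpow (hN _ hf) hq.le
    rw [ENNReal.mul_rpow_of_nonneg _ _ hq.le, eLpNorm_rpow_toReal hp0 hp,
      eLpNorm_rpow_toReal hp0 hp] at h
    calc ∫⁻ v in V, Φ a v ∂ν ≤ ∫⁻ v, Φ a v ∂ν := setLIntegral_le_lintegral _ _
      _ = ∫⁻ v, ‖squareFunction (fun j => scalarConv ν (k j)
            fun w => ∑ i, (φ i w : 𝕜) * a i) v‖ₑ ^ p.toReal ∂ν := by
          refine lintegral_congr fun v => ?_
          simp only [Φ, enorm_eq_self, squareFunction, scalarConv_sum_mul (hk _) hφ' hφc']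
      _ ≤ _ := h
      _ = (N : ℝ≥0∞) ^ p.toReal * ∫⁻ w in O, Ψ a w ∂ν := by
          rw [← lintegral_indicator hO]
          congr 1
          refine lintegral_congr fun w => ?_
          by_cases hw : w ∈ O
          · simp [hw, Ψ]
          · simp [hw, hφO _ w hw, hq]
  calc ∫⁻ v in V, eLpNorm (squareFunction fun j =>
        ⇑(∑ i, scalarConv ν (k j) (fun w => (φ i w : 𝕜)) v • g i)) p μ ^ p.toReal ∂ν
      = ∫⁻ v in V, ∫⁻ x, Φ (fun i => g i x) v ∂μ ∂ν := by
        refine lintegral_congr fun v => ?_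
        rw [eLpNorm_rpow_toReal hp0 hp]
        refine lintegral_congr_ae ?_
        filter_upwards [ae_all_iff.2 fun j =>
          hcoe fun i => scalarConv ν (k j) (fun w => (φ i w : 𝕜)) v] with x hx
        simp only [Φ, enorm_eq_self, squareFunction, hx]
    _ = ∫⁻ x, ∫⁻ v in V, Φ (fun i => g i x) v ∂ν ∂μ :=
        lintegral_lintegral_swap_of_memLp hp0 hp (fun i => Lp.memLp (g i)) hΦ hΦ0
    _ ≤ ∫⁻ x, (N : ℝ≥0∞) ^ p.toReal * ∫⁻ w in O, Ψ (fun i => g i x) w ∂ν ∂μ :=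
        lintegral_mono fun x => hpoint _
    _ = (N : ℝ≥0∞) ^ p.toReal * ∫⁻ w in O, ∫⁻ x, Ψ (fun i => g i x) w ∂μ ∂ν := by
        rw [lintegral_const_mul' _ _ (by finiteness),
          lintegral_lintegral_swap_of_memLp hp0 hp (fun i => Lp.memLp (g i)) hΨ hΨ0]
    _ ≤ (N : ℝ≥0∞) ^ p.toReal * ∫⁻ _ in O, (M : ℝ≥0∞) ^ p.toReal ∂ν := by
        gcongr with w
        have h1 : ‖∑ i, (φ i w : 𝕜) • g i‖ₑ ≤ M := enorm_le_coe.2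
          (norm_sum_smul_le (𝕜 := 𝕜) (fun i => hφ0 i w) (hφ1 w) M.coe_nonneg hg)
        refine le_trans (le_of_eq ?_) (ENNReal.rpow_le_rpow h1 hq.le)
        rw [Lp.enorm_def, eLpNorm_rpow_toReal hp0 hp]
        refine lintegral_congr_ae ?_
        filter_upwards [hcoe fun i => (φ i w : 𝕜)] with x hx
        simp only [Ψ, hx]
    _ = (N : ℝ≥0∞) ^ p.toReal * ((M : ℝ≥0∞) ^ p.toReal * ν O) := by
        rw [setLIntegral_const]

variable {R : G → Lp 𝕜 p μ →L[𝕜] Lp 𝕜 p μ} {c : ℝ≥0}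

theorem integrable_smul_rep (hR : IsStronglyContinuousRep R) (hc : ∀ u, ‖R u‖₊ ≤ c)
    {k : G → 𝕜} (hk : Integrable k ν) (f : Lp 𝕜 p μ) :
    Integrable (fun u => k u • R (-u) f) ν :=
  integrable_smul_of_continuous_of_bounded hk ((hR.continuous_apply f).comp continuous_neg)
    fun u => (R (-u)).le_of_opNorm_le (hc (-u)) f

theorem rep_transferOp (hR : IsStronglyContinuousRep R) (hc : ∀ u, ‖R u‖₊ ≤ c)
    {k : G → 𝕜} (hk : Integrable k ν) (f : Lp 𝕜 p μ) (v : G) :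
    R v (transferOp ν R k f) = ∫ u, k u • R (v - u) f ∂ν := by
  rw [transferOp, ← (R v).integral_comp_comm (integrable_smul_rep hR hc hk f)]
  refine integral_congr_ae (.of_forall fun u => ?_)
  simp [sub_eq_add_neg, hR.map_add]

variable [LocallyCompactSpace G] [ν.IsAddHaarMeasure]

/-- The transference inequality for finitely many kernels, up to an error that vanishes with
`t`: here `t` bounds the excess of the Følner ratio, the mass of the kernels off a compact set and
the approximation error for `u ↦ R u f`. -/
theorem eLpNorm_squareFunction_transferOp_le_add (hp : p ≠ ∞) (hR : IsStronglyContinuousRep R)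
    (hc : ∀ u, ‖R u‖₊ ≤ c) {k : J → G → 𝕜} (hk : ∀ j, Integrable (k j) ν) {N : ℝ≥0}
    (hN : ∀ f : G → 𝕜, MemLp f p ν →
      eLpNorm (squareFunction fun j => scalarConv ν (k j) f) p ν ≤ N * eLpNorm f p ν)
    (f : Lp 𝕜 p μ) {t : ℝ≥0} (ht : 0 < t) :
    eLpNorm (squareFunction fun j => ⇑(transferOp ν R (k j) f)) p μ ≤
      c * ((1 + t) * (N * (c * ‖f‖₊ : ℝ≥0) + t) +
        ∑ j, (t * ∫⁻ u, ‖k j u‖ₑ ∂ν + 2 * (c * ‖f‖₊ : ℝ≥0) * t)) := by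
  have hp0 : p ≠ 0 := (one_pos.trans_le Fact.out).ne'
  have hq : 0 < p.toReal := ENNReal.toReal_pos hp0 hp
  have hq1 : 1 ≤ p.toReal := by
    simpa using ENNReal.toReal_mono hp (Fact.out : 1 ≤ p)
  set M : ℝ≥0 := c * ‖f‖₊
  have hRM : ∀ u, ‖R u f‖ ≤ M := fun u => (R u).le_of_opNorm_le (hc u) f
  obtain ⟨K, hK, hKt⟩ := exists_isCompact_forall_lintegral_compl_le (ν := ν)
    (f := fun j u => ‖k j u‖ₑ) (fun j => (hk j).2.ne) (ε := t) (by simpa using ht.ne')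
  obtain ⟨V, O, hV, hO, hVO, hV0, hOtop, hratio⟩ :=
    exists_foelner_pair ν hK (r := 1 + t) (by simpa using ht)
  have hVK : IsCompact (V - K) := by
    rw [sub_eq_add_neg]
    exact hV.add hK.neg
  obtain ⟨n, φ, w, hφ, hφc, hφ0, hφ1, hφO, happ⟩ := exists_subpartition_norm_sub_sum_le (𝕜 := 𝕜)
    hVK hO hVO (hR.continuous_apply f) (ε := t) (by exact_mod_cast ht)
  let S : J → G → Lp 𝕜 p μ := fun j v =>
    ∑ i, scalarConv ν (k j) (fun w => (φ i w : 𝕜)) v • R (w i) f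
  -- The average over `V` of the `p`-th power of the square function of the `S j` is controlled,
  -- so some `v ∈ V` obeys the corresponding bound.
  obtain ⟨v, hvV, hv⟩ : ∃ v ∈ V, eLpNorm (squareFunction fun j => ⇑(S j v)) p μ ≤
      ((1 + t) * (N * M + t) : ℝ≥0) := by
    by_contra! H
    have h1 : ((((1 + t) * (N * M + t) : ℝ≥0) : ℝ≥0∞) ^ p.toReal) * ν V ≤
        (N : ℝ≥0∞) ^ p.toReal * ((M : ℝ≥0∞) ^ p.toReal * ν O) := by
      refine le_trans ?_ (lintegral_eLpNorm_squareFunction_sum_scalarConv_le hp hk hN hφ hφc hφ0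
        hφ1 hO.measurableSet hOtop hφO hV.measure_ne_top (g := fun i => R (w i) f)
        fun i => hRM (w i))
      rw [← setLIntegral_const]
      exact setLIntegral_mono' hV.measurableSet fun v hv => ENNReal.rpow_le_rpow (H v hv).le hq.le
    have h2 : ((((1 + t) * (N * M + t) : ℝ≥0) : ℝ≥0∞) ^ p.toReal) * ν V ≤
        ((N : ℝ≥0∞) ^ p.toReal * (M : ℝ≥0∞) ^ p.toReal * (1 + t : ℝ≥0)) * ν V := by
      refine h1.trans ?_
      rw [mul_assoc, mul_assoc]
      gcongr
    rw [ENNReal.mul_le_mul_iff_left hV0 hV.measure_ne_top] at h2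
    simp only [← ENNReal.coe_rpow_of_nonneg _ hq.le, ← ENNReal.coe_mul, ENNReal.coe_le_coe,
      ← NNReal.mul_rpow] at h2
    refine h2.not_gt ?_
    calc (N * M) ^ p.toReal * (1 + t) < (N * M + t) ^ p.toReal * (1 + t) := by
          gcongr
          exact lt_add_of_pos_right _ ht
      _ ≤ (N * M + t) ^ p.toReal * (1 + t) ^ p.toReal := by
          gcongr
          simpa using NNReal.rpow_le_rpow_of_exponent_le (x := 1 + t) (by simp) hq1
      _ = ((1 + t) * (N * M + t)) ^ p.toReal := by rw [NNReal.mul_rpow, mul_comm]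
  have hback : ∀ x : Lp 𝕜 p μ, R (-v) (R v x) = x := fun x => by
    have h := hR.map_add (-v) v
    rw [neg_add_cancel, hR.map_zero] at h
    exact (congrArg (fun A : Lp 𝕜 p μ →L[𝕜] Lp 𝕜 p μ => A x) h).symm
  calc eLpNorm (squareFunction fun j => ⇑(transferOp ν R (k j) f)) p μ
      = eLpNorm (squareFunction fun j => ⇑(R (-v) (R v (transferOp ν R (k j) f)))) p μ := by
        simp only [hback]
    _ ≤ ‖R (-v)‖ₑ * eLpNorm (squareFunction fun j => ⇑(R v (transferOp ν R (k j) f))) p μ :=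
        eLpNorm_squareFunction_clm_le hp _ _
    _ ≤ c * (eLpNorm (squareFunction fun j => ⇑(S j v)) p μ +
          ∑ j, eLpNorm (⇑(R v (transferOp ν R (k j) f)) - ⇑(S j v)) p μ) := by
        gcongr
        · exact enorm_le_coe.2 (hc (-v))
        · exact eLpNorm_squareFunction_le_add Fact.out (fun j => Lp.aestronglyMeasurable _)
            fun j => Lp.aestronglyMeasurable _
    _ ≤ _ := by
        gcongr with j
        · exact hv.trans_eq (by push_cast; rfl)
        · rw [← eLpNorm_congr_ae (Lp.coeFn_sub _ _), ← Lp.enorm_def, rep_transferOp hR hc (hk j)]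
          refine (enorm_integral_smul_sub_sum_scalarConv_le (hk j) (hR.continuous_apply f) hRM
            hφ hφc hφ0 hφ1 (fun i => hRM (w i)) hK.measurableSet (ε := t)
            fun u hu => happ _ (Set.sub_mem_sub hvV hu)).trans ?_
          gcongr
          exact hKt j

theorem eLpNorm_squareFunction_transferOp_le (hp : p ≠ ∞) (hR : IsStronglyContinuousRep R)
    (hc : ∀ u, ‖R u‖₊ ≤ c) {k : J → G → 𝕜} (hk : ∀ j, Integrable (k j) ν) {N : ℝ≥0}
    (hN : ∀ f : G → 𝕜, MemLp f p ν →
      eLpNorm (squareFunction fun j => scalarConv ν (k j) f) p ν ≤ N * eLpNorm f p ν)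
    (f : Lp 𝕜 p μ) :
    eLpNorm (squareFunction fun j => ⇑(transferOp ν R (k j) f)) p μ ≤
      (c : ℝ≥0∞) ^ 2 * N * eLpNorm f p μ := by
  let A : J → ℝ≥0 := fun j => (∫⁻ u, ‖k j u‖ₑ ∂ν).toNNReal
  have hA : ∀ j, (A j : ℝ≥0∞) = ∫⁻ u, ‖k j u‖ₑ ∂ν := fun j => ENNReal.coe_toNNReal (hk j).2.ne
  let h : ℝ≥0 → ℝ≥0 := fun t => c * ((1 + t) * (N * (c * ‖f‖₊) + t) +
    ∑ j, (t * A j + 2 * (c * ‖f‖₊) * t))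
  have hcont : Continuous h := by fun_prop
  have hlim : Filter.Tendsto (fun t => (h t : ℝ≥0∞)) (nhdsWithin 0 (Set.Ioi 0))
      (nhds (h 0 : ℝ≥0∞)) :=
    ((ENNReal.continuous_coe.comp hcont).tendsto 0).mono_left nhdsWithin_le_nhds
  have hle : eLpNorm (squareFunction fun j => ⇑(transferOp ν R (k j) f)) p μ ≤ h 0 := by
    refine ge_of_tendsto hlim ?_
    filter_upwards [self_mem_nhdsWithin] with t ht
    refine (eLpNorm_squareFunction_transferOp_le_add hp hR hc hk hN f ht).trans_eq ?_
    simp only [h, ← hA]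
    push_cast
    rfl
  refine hle.trans_eq ?_
  rw [← Lp.enorm_def, enorm_eq_nnnorm]
  simp only [h, add_zero, one_mul, zero_mul, mul_zero, Finset.sum_const_zero]
  push_cast
  ring

end Transference

theorem theorem2p9 {𝕜 G Ω ι : Type*} [RCLike 𝕜]
    [AddCommGroup G] [TopologicalSpace G] [IsTopologicalAddGroup G] [T2Space G]
    [LocallyCompactSpace G] [MeasurableSpace G] [BorelSpace G]
    (ν : Measure G) [ν.IsAddHaarMeasure] [ν.Regular]
    [MeasurableSpace Ω] (μ : Measure Ω)
    (p : ℝ≥0∞) [Fact (1 ≤ p)] (hp : p ≠ ∞)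
    (R : G → Lp 𝕜 p μ →L[𝕜] Lp 𝕜 p μ) (hR : IsStronglyContinuousRep R)
    (c : ℝ≥0) (hc : IsLUB (Set.range fun u : G => ‖R u‖₊) c)
    [Countable ι] (k : ι → G → 𝕜) (hk : ∀ j, Integrable (k j) ν)
    (hN : squareNorm ν p k < ∞) :
    (∀ (j : ι) (f : Lp 𝕜 p μ), Integrable (fun u => k j u • R (-u) f) ν) ∧
    ∀ f : Lp 𝕜 p μ,
      (∀ᵐ x ∂μ, squareFunction (fun j => ⇑(transferOp ν R (k j) f)) x < ∞) ∧
      MemLp (squareFunction fun j => ⇑(transferOp ν R (k j) f)) p μ ∧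
      eLpNorm (squareFunction fun j => ⇑(transferOp ν R (k j) f)) p μ
        ≤ (c : ℝ≥0∞) ^ 2 * squareNorm ν p k * eLpNorm f p μ := by
  have hp0 : p ≠ 0 := (one_pos.trans_le Fact.out).ne'
  have hq : 0 < p.toReal := ENNReal.toReal_pos hp0 hp
  have hc' : ∀ u, ‖R u‖₊ ≤ c := fun u => hc.1 ⟨u, rfl⟩
  refine ⟨fun j f => integrable_smul_rep hR hc' (hk j) f, fun f => ?_⟩
  have hmeas : AEMeasurable (squareFunction fun j => ⇑(transferOp ν R (k j) f)) μ :=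
    aemeasurable_squareFunction fun j => Lp.aestronglyMeasurable _
  have hle : eLpNorm (squareFunction fun j => ⇑(transferOp ν R (k j) f)) p μ ≤
      (c : ℝ≥0∞) ^ 2 * squareNorm ν p k * eLpNorm f p μ := by
    refine eLpNorm_squareFunction_le_of_finset (fun j => Lp.aestronglyMeasurable _) hp0 hp
      fun s => ?_
    obtain ⟨N, hN'⟩ : ∃ N : ℝ≥0, (N : ℝ≥0∞) = squareNorm ν p k := ⟨_, ENNReal.coe_toNNReal hN.ne⟩
    rw [← hN']
    refine eLpNorm_squareFunction_transferOp_le (k := fun j : s => k j) hp hR hc'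
      (fun j => hk j) (fun h hh => ?_) f
    rw [hN']
    refine le_trans (eLpNorm_mono_enorm fun v => ?_) (eLpNorm_squareFunction_scalarConv_le hN hh)
    exact squareFunction_comp_le Subtype.val_injective (fun j => scalarConv ν (k j) h) v
  have hlt : eLpNorm (squareFunction fun j => ⇑(transferOp ν R (k j) f)) p μ < ∞ :=
    hle.trans_lt (ENNReal.mul_lt_top (ENNReal.mul_lt_top (by finiteness) hN) (Lp.eLpNorm_lt_top f))
  refine ⟨?_, ⟨hmeas.aestronglyMeasurable, hlt⟩, hle⟩
  have hint := lintegral_rpow_enorm_lt_top_of_eLpNorm_lt_top hp0 hp hlt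
  simp only [enorm_eq_self] at hint
  filter_upwards [ae_lt_top' (hmeas.pow_const _) hint.ne] with x hx
  exact (ENNReal.rpow_lt_top_iff_of_pos hq).1 hx
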